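/- Let $q$ be a power of an odd prime $p$, let $V$ be a vector space of dimension $2n$ over $GF(q)$ with a nondegenerate symplectic form $\varphi$, and let $\mathrm{Sp}(V)$ be its symplectic group, acting on the right ($x\mapsto x^g$). Let $K=\mathbb{Q}(e^{2\pi i/p})\subset\mathbb{C}$, let $\psi(\alpha)=e^{(2\pi i/p)\,\mathrm{tr}(\alpha)}$ be the canonical additive character of $GF(q)$ ($\mathrm{tr}$ the trace to $GF(p)$), let $\chi$ be the quadratic character of $GF(q)$, and let $\rho=\sum_{\alpha\in GF(q)}\psi(\alpha^2)$. Let $\mathcal A$ be the symplectic algebra: the $K$-algebra with basis $\{(x): x\in V\}$ and product $(x)(y)=\psi(\varphi(x,y))\,(x+y)$. For $g\in\mathrm{Sp}(V)$ let $V^{g-1}$ be the image of $g-1$, let $\Theta_g$ be Wall's theta form on $V^{g-1}$, that is, the (well-defined) bilinear form with $\Theta_g(x^{g-1},y^{g-1})=\varphi(x^{g-1},y)$, and let $Q_g(u)=\Theta_g(u,u)$. Put $$s(g)=\sum_{y\in V^{g-1}}\psi(Q_g(y))\,(y)\in\mathcal A .$$ Let $V=W\oplus W^{*}$ with $W,W^{*}$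 Lagrangian (maximal totally isotropic), let $e_0=q^{-n}\sum_{w\in W}(w)$ and $e_{ab}=(-a)e_0(b)$ for $a,b\in W^{*}$. The $e_{ab}$ are matrix units forming a $K$-basis of $\mathcal A$; for $\mathfrak a=\sum_{a,b}\alpha_{ab}e_{ab}$ write $[\mathfrak a]=[\alpha_{ab}]$, a $q^n\times q^n$ matrix. Partition $W^{*}$ as $P\cup -P\cup\{0\}$, and let $\mathfrak a^{\flat}$ be the matrix with entries $\alpha_{ab}-\alpha_{a,-b}$, $a,b\in P$. Define $$\eta(g)=\bigl(\det s(g)^{\flat}\bigr)^{2}\,\bigl(\det [s(g)]\bigr)^{-1},\qquad t(g)=\eta(g)s(g),\qquad \omega(g)=\mathrm{tr}\,[t(g)] .$$ **Theorem.** For every such choice of $W$, $W^{*}$ and $P$: 1. For every $g\in\mathrm{Sp}(V)$, $s(g)$ is the unique invertible element of $\mathcal A$ with $(0)$-coefficient $1$ such that $s(g)^{-1}(x)s(g)=(x^{g})$ for all $x\in V$. 2. $t(1)=1$ and $t(gh)=t(g)t(h)$ for all $g,h\in\mathrm{Sp}(V)$; thus $g\mapsto t(g)$ is an ordinary representation (the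 Weil representation), with character $\omega$. 3. For every $g\in \mathrm{Sp}(V)$, $$\eta(g)=\rho^{-\dim V^{g-1}}\,\chi(\det\Theta_g)\qquad\text{and}\qquad \omega(g)=q^{n}\rho^{-\dim V^{g-1}}\,\chi(\det\Theta_g),$$ where $\det\Theta_g$ is computed relative to any basis of $V^{g-1}$ (and is $1$ if $V^{g-1}=0$). -/

import Mathlib

namespace WeilRep

set_option linter.unusedSectionVars false

noncomputable section

open scoped Classical
open Module

/-! ## The coefficient field and the canonical additive character -/

/-- The field `K = ℚ(e^{2πi/p})`, as a subfield of `ℂ`. -/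
def CycField (p : ℕ) : Type :=
  ↥(IntermediateField.adjoin ℚ {Complex.exp (2 * Real.pi * Complex.I / p)})

instance (p : ℕ) : Field (CycField p) :=
  inferInstanceAs (Field
    ↥(IntermediateField.adjoin ℚ {Complex.exp (2 * Real.pi * Complex.I / p)}))

/-- The inclusion of `K` into `ℂ`. -/
def toComplex (p : ℕ) : CycField p →+* ℂ :=
  (IntermediateField.adjoin ℚ {Complex.exp (2 * Real.pi * Complex.I / p)}).val.toRingHom

instance (p : ℕ) : CharZero (CycField p) :=
  (toComplex p).charZero

/-- The root of unity `e^{2πi/p}` as an element of `K`. -/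
def zeta (p : ℕ) : CycField p :=
  ⟨Complex.exp (2 * Real.pi * Complex.I / p),
    IntermediateField.subset_adjoin ℚ _ (Set.mem_singleton _)⟩

theorem zeta_isPrimitiveRoot (p : ℕ) [Fact p.Prime] : IsPrimitiveRoot (zeta p) p := by
  have h := Complex.isPrimitiveRoot_exp p (Fact.out : p.Prime).ne_zero
  exact IsPrimitiveRoot.of_map_of_injective (f := toComplex p) h (toComplex p).injective

theorem zeta_pow (p : ℕ) [Fact p.Prime] : zeta p ^ p = 1 := (zeta_isPrimitiveRoot p).pow_eq_one

variable (p : ℕ) [Fact p.Prime]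
variable {F : Type*} [Field F]

section Scalars

variable [Fintype F]

/-- The quadratic character `χ` of `F`, with values in `K`. -/
def chi (α : F) : CycField p := ((quadraticChar F α : ℤ) : CycField p)

variable [Algebra (ZMod p) F]

/-- The canonical additive character `ψ(α) = e^{(2πi/p) tr(α)}` of the finite field `F`, where
`tr : F → GF(p)` is the trace. -/
def psi : AddChar F (CycField p) :=
  (AddChar.zmodChar p (zeta_pow p)).compAddMonoidHom (Algebra.trace (ZMod p) F).toAddMonoidHom

variable (F) in
/-- The quadratic Gauss sum `ρ = ∑_α ψ(α²)`. -/
def rho : CycField p := ∑ α : F, psi p (α ^ 2)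

end Scalars

/-! ## Symplectic spaces, the symplectic group, theta forms -/

/-- A nondegenerate symplectic (alternating bilinear) form on `V`. -/
structure SymplecticForm (F V : Type*) [Field F] [AddCommGroup V] [Module F V] where
  form : LinearMap.BilinForm F V
  alt : form.IsAlt
  nondegenerate : form.Nondegenerate

variable {V : Type*} [AddCommGroup V] [Module F V]
variable (φ : SymplecticForm F V)

theorem SymplecticForm.neg_swap (x y : V) : -φ.form x y = φ.form y x :=
  LinearMap.BilinForm.IsAlt.neg_eq φ.alt x y

/-- The symplectic group `Sp(V)`. Its multiplication is composition of maps, `(g * h) v = g (h v)`,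
so that a product `gh` of maps acting on the right is `h * g` here. -/
def Sp : Subgroup (V ≃ₗ[F] V) where
  carrier := {g | ∀ x y, φ.form (g x) (g y) = φ.form x y}
  mul_mem' {g h} hg hh x y := by
    rw [LinearEquiv.mul_apply, LinearEquiv.mul_apply, hg, hh]
  one_mem' x y := rfl
  inv_mem' {g} hg x y := by
    have h := hg (g⁻¹ x) (g⁻¹ y)
    have e : ∀ z, g (g⁻¹ z) = z := fun z => g.apply_symm_apply z
    rw [e, e] at h
    exact h.symm

variable {φ}

/-- The linear map `g - 1`. -/
def subOne (g : Sp φ) : V →ₗ[F] V := ((g : V ≃ₗ[F] V) : V →ₗ[F] V) - LinearMap.id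

/-- The space `V^{g-1}`, the image of `g - 1`. -/
abbrev moved (g : Sp φ) : Submodule F V := LinearMap.range (subOne g)

theorem exists_section (g : Sp φ) :
    ∃ σ : moved g →ₗ[F] V, (subOne g).rangeRestrict ∘ₗ σ = LinearMap.id :=
  LinearMap.exists_rightInverse_of_surjective _ (LinearMap.range_rangeRestrict _)

/-- Wall's theta form on `V^{g-1}`: `Θ_g(u, v) = φ(u, y)` for any `y` with `y^{g-1} = v`
(see `theta_apply`). -/
def theta (g : Sp φ) : LinearMap.BilinForm F (moved g) :=
  φ.form.compl₁₂ (moved g).subtype (exists_section g).choose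

/-- The defining property `Θ_g(x^{g-1}, y^{g-1}) = φ(x^{g-1}, y)` of the theta form. -/
theorem theta_apply (g : Sp φ) (x y : V) :
    theta g ((subOne g).rangeRestrict x) ((subOne g).rangeRestrict y) =
      φ.form (subOne g x) y := by
  set σ := (exists_section g).choose with hσ
  have h1 : subOne g (σ ((subOne g).rangeRestrict y)) = subOne g y :=
    congrArg Subtype.val (LinearMap.congr_fun (exists_section g).choose_spec
      ((subOne g).rangeRestrict y))
  have h2 : subOne g (σ ((subOne g).rangeRestrict y) - y) = 0 := by rw [map_sub, h1, sub_self]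
  set d := σ ((subOne g).rangeRestrict y) - y with hd
  have h3 : (g : V ≃ₗ[F] V) d = d := by
    have : (g : V ≃ₗ[F] V) d - d = 0 := h2
    exact sub_eq_zero.mp this
  have h4 : φ.form (subOne g x) d = 0 := by
    have h5 := g.2 x d
    rw [h3] at h5
    have h7 : subOne g x = (g : V ≃ₗ[F] V) x - x := rfl
    rw [h7, LinearMap.BilinForm.sub_left, h5, sub_self]
  have h6 : φ.form (subOne g x) (σ ((subOne g).rangeRestrict y)) = φ.form (subOne g x) y := by
    rw [← sub_eq_zero, ← map_sub]; exact h4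
  exact h6

/-- The quadratic form `Q_g` of the theta form, `Q_g(u) = Θ_g(u, u)`. -/
def thetaQuad (g : Sp φ) : QuadraticForm F (moved g) := (theta g).toQuadraticMap

/-! ## The symplectic algebra -/

variable [Fintype F] [Algebra (ZMod p) F] (φ)

/-- The symplectic algebra `𝒜`: the twisted group ring over `K` of the additive group of `V` with
factor set `f(x, y) = ψ(φ(x, y))`. Its elements are the functions `V → K` (coefficients with
respect to the basis elements `(x)`, `x ∈ V`). -/
def SympAlg (_φ : SymplecticForm F V) : Type _ := V → CycField p

/-- The factor set `f(x, y) = ψ(φ(x, y))`. -/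
def factor (x y : V) : CycField p := psi p (φ.form x y)

section Factor

variable {p φ}

theorem factor_add_left (x y z : V) : factor p φ (x + y) z = factor p φ x z * factor p φ y z := by
  simp only [factor, map_add, LinearMap.add_apply, AddChar.map_add_eq_mul]

theorem factor_add_right (x y z : V) :
    factor p φ x (y + z) = factor p φ x y * factor p φ x z := by
  simp only [factor, map_add, AddChar.map_add_eq_mul]

theorem factor_eq_one {x y : V} (h : φ.form x y = 0) : factor p φ x y = 1 := by
  rw [factor, h, AddChar.map_zero_eq_one]

theorem factor_zero_left (x : V) : factor p φ 0 x = 1 := factor_eq_one (by simp)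

theorem factor_zero_right (x : V) : factor p φ x 0 = 1 := factor_eq_one (by simp)

theorem factor_mul_swap (x y : V) : factor p φ x y * factor p φ y x = 1 := by
  rw [factor, factor, ← AddChar.map_add_eq_mul, ← φ.neg_swap x y, add_neg_cancel,
    AddChar.map_zero_eq_one]

end Factor

variable [Fintype V]

namespace SympAlg

instance : AddCommGroup (SympAlg p φ) := inferInstanceAs (AddCommGroup (V → CycField p))
instance : Module (CycField p) (SympAlg p φ) :=
  inferInstanceAs (Module (CycField p) (V → CycField p))

/-- The basis element `(x)`. -/
def of (x : V) : SympAlg p φ := Pi.single (M := fun _ => CycField p) x 1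

instance : One (SympAlg p φ) := ⟨of p φ 0⟩

/-- The product, bilinear with `(x)(y) = f(x, y)(x + y)` (see `of_mul_of`). -/
instance : Mul (SympAlg p φ) :=
  ⟨fun a b z => ∑ x : V, a x * b (z - x) * factor p φ x (z - x)⟩

variable {p φ}

theorem ext' {a b : SympAlg p φ} (h : ∀ x, a x = b x) : a = b := funext h

theorem mul_apply (a b : SympAlg p φ) (z : V) :
    (a * b) z = ∑ x : V, a x * b (z - x) * factor p φ x (z - x) := rfl

theorem add_apply (a b : SympAlg p φ) (z : V) : (a + b) z = a z + b z := rfl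

theorem zero_apply (z : V) : (0 : SympAlg p φ) z = 0 := rfl

theorem smul_apply (c : CycField p) (a : SympAlg p φ) (z : V) : (c • a) z = c * a z := rfl

theorem of_apply (x z : V) : of p φ x z = if z = x then 1 else 0 := Pi.single_apply _ _ _

theorem one_def : (1 : SympAlg p φ) = of p φ 0 := rfl

theorem of_mul_apply (x : V) (b : SympAlg p φ) (z : V) :
    (of p φ x * b) z = b (z - x) * factor p φ x (z - x) := by
  rw [mul_apply, Finset.sum_eq_single x]
  · rw [of_apply, if_pos rfl, one_mul]
  · intro y _ hy
    rw [of_apply, if_neg hy, zero_mul, zero_mul]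
  · intro h; exact absurd (Finset.mem_univ x) h

theorem of_mul_of (x y : V) : of p φ x * of p φ y = factor p φ x y • of p φ (x + y) := by
  refine ext' fun z => ?_
  rw [of_mul_apply, smul_apply, of_apply, of_apply]
  by_cases h : z = x + y
  · subst h; simp
  · have h' : z - x ≠ y := fun e => h (by rw [← e]; abel)
    rw [if_neg h, if_neg h']; simp

protected theorem mul_assoc' (a b c : SympAlg p φ) : a * b * c = a * (b * c) := by
  refine ext' fun z => ?_
  rw [mul_apply, mul_apply]
  simp only [mul_apply, Finset.sum_mul, Finset.mul_sum]
  rw [Finset.sum_comm]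
  refine Finset.sum_congr rfl fun x _ => ?_
  refine Fintype.sum_equiv (Equiv.subRight x) _ _ fun y => ?_
  simp only [Equiv.subRight_apply]
  have e1 : z - x - (y - x) = z - y := by abel
  have e2 : z - x = (y - x) + (z - y) := by abel
  have e3 : factor p φ y (z - y) = factor p φ x (z - y) * factor p φ (y - x) (z - y) := by
    rw [← factor_add_left]; congr 1; abel
  rw [e1, e3]
  conv_rhs => rw [e2, factor_add_right]
  ring

protected theorem one_mul' (a : SympAlg p φ) : 1 * a = a := by
  refine ext' fun z => ?_
  rw [one_def, of_mul_apply, sub_zero, factor_zero_left, mul_one]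

protected theorem mul_one' (a : SympAlg p φ) : a * 1 = a := by
  refine ext' fun z => ?_
  rw [one_def, mul_apply, Finset.sum_eq_single z]
  · rw [sub_self, of_apply, if_pos rfl, factor_zero_right, mul_one, mul_one]
  · intro y _ hy
    rw [of_apply, if_neg (sub_ne_zero.mpr (Ne.symm hy)), mul_zero, zero_mul]
  · intro h; exact absurd (Finset.mem_univ z) h

instance : Ring (SympAlg p φ) :=
  { (inferInstance : AddCommGroup (SympAlg p φ)),
    (inferInstance : Mul (SympAlg p φ)),
    (inferInstance : One (SympAlg p φ)) with
    mul_assoc := SympAlg.mul_assoc'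
    one_mul := SympAlg.one_mul'
    mul_one := SympAlg.mul_one'
    left_distrib := fun a b c => ext' fun z => by
      simp only [mul_apply, add_apply, mul_add, add_mul, Finset.sum_add_distrib]
    right_distrib := fun a b c => ext' fun z => by
      simp only [mul_apply, add_apply, add_mul, Finset.sum_add_distrib]
    zero_mul := fun a => ext' fun z => by
      simp only [mul_apply, zero_apply, zero_mul, Finset.sum_const_zero]
    mul_zero := fun a => ext' fun z => by
      simp only [mul_apply, zero_apply, mul_zero, zero_mul, Finset.sum_const_zero] }

instance : Algebra (CycField p) (SympAlg p φ) :=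
  Algebra.ofModule
    (fun c a b => ext' fun z => by
      simp only [mul_apply, smul_apply, Finset.mul_sum]
      exact Finset.sum_congr rfl fun x _ => by ring)
    (fun c a b => ext' fun z => by
      simp only [mul_apply, smul_apply, Finset.mul_sum]
      exact Finset.sum_congr rfl fun x _ => by ring)

end SympAlg

open SympAlg

variable {φ}

/-- The element `s(g) = ∑_{y ∈ V^{g-1}} ψ(Q_g(y)) (y)` of the symplectic algebra. -/
def spin (g : Sp φ) : SympAlg p φ :=
  ∑ y : moved g, psi p (thetaQuad g y) • of p φ (y : V)

/-! ## The matrix realization -/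

variable (φ) in
/-- Two complementary Lagrangian (maximal totally isotropic) subspaces `W`, `W*` of `V`. -/
structure LagrangianPair where
  W : Submodule F V
  Wst : Submodule F V
  lagrangian : Maximal (fun U : Submodule F V => ∀ x ∈ U, ∀ y ∈ U, φ.form x y = 0) W
  lagrangian_st : Maximal (fun U : Submodule F V => ∀ x ∈ U, ∀ y ∈ U, φ.form x y = 0) Wst
  isCompl : IsCompl W Wst

variable (L : LagrangianPair φ)

/-- The idempotent `e₀ = |W|⁻¹ ∑_{w ∈ W} (w)`; here `|W| = q^n`. -/
def eZero : SympAlg p φ := (Fintype.card L.W : CycField p)⁻¹ • ∑ w : L.W, of p φ (w : V)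

/-- The matrix units `e_{ab} = (-a) e₀ (b)`, `a, b ∈ W*`. -/
def eUnit (a b : L.Wst) : SympAlg p φ := of p φ (-a : V) * eZero p L * of p φ (b : V)

section MatrixUnits

variable {p L}

theorem form_W {x y : V} (hx : x ∈ L.W) (hy : y ∈ L.W) : φ.form x y = 0 :=
  L.lagrangian.prop x hx y hy

theorem form_Wst {x y : V} (hx : x ∈ L.Wst) (hy : y ∈ L.Wst) : φ.form x y = 0 :=
  L.lagrangian_st.prop x hx y hy

theorem mem_of_orthogonal {U : Submodule F V}
    (hU : Maximal (fun U : Submodule F V => ∀ x ∈ U, ∀ y ∈ U, φ.form x y = 0) U)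
    {x : V} (hx : ∀ w ∈ U, φ.form w x = 0) : x ∈ U := by
  have h : U ⊔ Submodule.span F {x} ≤ U := by
    refine hU.le_of_ge ?_ le_sup_left
    intro y hy z hz
    obtain ⟨u, hu, c, rfl⟩ : ∃ u ∈ U, ∃ c : F, u + c • x = y := by
      obtain ⟨u, hu, v, hv, rfl⟩ := Submodule.mem_sup.mp hy
      obtain ⟨c, rfl⟩ := Submodule.mem_span_singleton.mp hv
      exact ⟨u, hu, c, rfl⟩
    obtain ⟨u', hu', c', rfl⟩ : ∃ u ∈ U, ∃ c : F, u + c • x = z := by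
      obtain ⟨u, hu, v, hv, rfl⟩ := Submodule.mem_sup.mp hz
      obtain ⟨c, rfl⟩ := Submodule.mem_span_singleton.mp hv
      exact ⟨u, hu, c, rfl⟩
    have h1 : φ.form x u' = 0 := by rw [← φ.neg_swap, hx u' hu', neg_zero]
    simp [hU.prop u hu u' hu', hx u hu, h1, φ.alt x]
  exact h (Submodule.mem_sup_right (Submodule.mem_span_singleton_self x))

theorem two_mul_finrank {U : Submodule F V}
    (hU : Maximal (fun U : Submodule F V => ∀ x ∈ U, ∀ y ∈ U, φ.form x y = 0) U) :
    2 * finrank F U = finrank F V := by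
  have h : φ.form.orthogonal U = U := by
    ext x
    rw [LinearMap.BilinForm.mem_orthogonal_iff]
    exact ⟨fun hx => mem_of_orthogonal hU hx, fun hx w hw => hU.prop w hw x hx⟩
  have h1 := LinearMap.BilinForm.finrank_orthogonal φ.nondegenerate U
  rw [h] at h1
  have h2 := Submodule.finrank_le U
  omega

theorem eq_zero_of_mem_inf {x : V} (h : x ∈ L.W) (h' : x ∈ L.Wst) : x = 0 :=
  (Submodule.disjoint_def.mp L.isCompl.disjoint) x h h'

theorem exists_psi_ne_one : ∃ α : F, psi p α ≠ 1 := by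
  obtain ⟨a, ha⟩ := Algebra.trace_surjective (ZMod p) F 1
  refine ⟨a, fun h => ?_⟩
  have h1 : zeta p ^ (Algebra.trace (ZMod p) F a).val = 1 := h
  rw [ha, ZMod.val_one, pow_one] at h1
  exact (zeta_isPrimitiveRoot p).ne_one (Fact.out : p.Prime).one_lt h1

variable (p F) in
theorem two_ne_zero_of_odd (hp : p ≠ 2) : (2 : F) ≠ 0 := by
  have : CharP F p := charP_of_injective_algebraMap (algebraMap (ZMod p) F).injective p
  exact Ring.two_ne_zero (by rwa [ringChar.eq F p])

theorem exists_factor_sq_ne_one (hp : p ≠ 2) {x : V} (hx : x ∉ L.W) :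
    ∃ w ∈ L.W, factor p φ w x * factor p φ w x ≠ 1 := by
  obtain ⟨w, hw, h⟩ : ∃ w ∈ L.W, φ.form w x ≠ 0 := by
    by_contra! h
    exact hx (mem_of_orthogonal L.lagrangian h)
  obtain ⟨α, hα⟩ := exists_psi_ne_one (p := p) (F := F)
  have h2 : (2 : F) ≠ 0 := two_ne_zero_of_odd p F hp
  refine ⟨(α / (2 * φ.form w x)) • w, L.W.smul_mem _ hw, ?_⟩
  rw [factor, ← AddChar.map_add_eq_mul]
  convert hα using 2
  rw [map_smul, LinearMap.smul_apply, smul_eq_mul]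
  field_simp
  norm_num

theorem of_mul_eZero {w : V} (hw : w ∈ L.W) : of p φ w * eZero p L = eZero p L := by
  rw [eZero, mul_smul_comm, Finset.mul_sum]
  congr 1
  refine Fintype.sum_equiv (Equiv.addLeft (⟨w, hw⟩ : L.W)) _ _ fun y => ?_
  rw [of_mul_of, factor_eq_one (form_W hw y.2), one_smul]
  rfl

theorem eZero_mul_of {w : V} (hw : w ∈ L.W) : eZero p L * of p φ w = eZero p L := by
  rw [eZero, smul_mul_assoc, Finset.sum_mul]
  congr 1
  refine Fintype.sum_equiv (Equiv.addRight (⟨w, hw⟩ : L.W)) _ _ fun y => ?_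
  rw [of_mul_of, factor_eq_one (form_W y.2 hw), one_smul]
  rfl

theorem card_W_ne_zero : (Fintype.card L.W : CycField p) ≠ 0 :=
  Nat.cast_ne_zero.mpr Fintype.card_ne_zero

theorem eZero_mul_eZero : eZero p L * eZero p L = eZero p L := by
  have h : eZero p L * eZero p L = (Fintype.card L.W : CycField p)⁻¹ •
      ((∑ w : L.W, of p φ (w : V)) * eZero p L) := by
    rw [← smul_mul_assoc]; rfl
  rw [h, Finset.sum_mul,
    Finset.sum_congr rfl fun w _ => of_mul_eZero w.2, Finset.sum_const, Finset.card_univ,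
    ← Nat.cast_smul_eq_nsmul (CycField p), inv_smul_smul₀ card_W_ne_zero]

theorem eZero_of_eZero_mem {x : V} (hx : x ∈ L.W) :
    eZero p L * of p φ x * eZero p L = eZero p L := by
  rw [eZero_mul_of hx, eZero_mul_eZero]

theorem eZero_of_eZero_notMem (hp : p ≠ 2) {x : V} (hx : x ∉ L.W) :
    eZero p L * of p φ x * eZero p L = 0 := by
  obtain ⟨w, hw, h⟩ := exists_factor_sq_ne_one (p := p) hp hx
  have h1 : of p φ w * of p φ x = (factor p φ w x * factor p φ w x) • (of p φ x * of p φ w) := by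
    rw [of_mul_of, of_mul_of, smul_smul, mul_assoc, factor_mul_swap, mul_one, add_comm w x]
  have h2 : eZero p L * of p φ x * eZero p L =
      (factor p φ w x * factor p φ w x) • (eZero p L * of p φ x * eZero p L) := by
    calc eZero p L * of p φ x * eZero p L
        = eZero p L * (of p φ w * of p φ x) * eZero p L := by
          rw [← mul_assoc, eZero_mul_of hw]
      _ = (factor p φ w x * factor p φ w x) •
            (eZero p L * of p φ x * (of p φ w * eZero p L)) := by
          rw [h1, mul_smul_comm, smul_mul_assoc]; simp only [mul_assoc]
      _ = _ := by rw [of_mul_eZero hw]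
  by_contra h3
  have h4 : (1 - factor p φ w x * factor p φ w x) • (eZero p L * of p φ x * eZero p L) = 0 := by
    rw [sub_smul, one_smul, ← h2, sub_self]
  rcases smul_eq_zero.mp h4 with h5 | h5
  · exact h (sub_eq_zero.mp h5).symm
  · exact h3 h5

theorem of_mul_of_Wst (b c : L.Wst) :
    of p φ (b : V) * of p φ (-c : V) = of p φ ((b - c : L.Wst) : V) := by
  rw [of_mul_of, factor_eq_one (form_Wst b.2 (L.Wst.neg_mem c.2)), one_smul, sub_eq_add_neg]
  rfl

theorem eUnit_mul_eUnit (hp : p ≠ 2) (a b c d : L.Wst) :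
    eUnit p L a b * eUnit p L c d = if b = c then eUnit p L a d else 0 := by
  have h : eUnit p L a b * eUnit p L c d = of p φ (-a : V) *
      (eZero p L * of p φ ((b - c : L.Wst) : V) * eZero p L) * of p φ (d : V) := by
    rw [eUnit, eUnit, ← of_mul_of_Wst]
    simp only [mul_assoc]
  rw [h]
  split_ifs with hbc
  · subst hbc
    rw [sub_self, eZero_of_eZero_mem (by simp), eUnit]
  · rw [eZero_of_eZero_notMem hp, mul_zero, zero_mul]
    intro hm
    exact hbc (sub_eq_zero.mp (Subtype.ext (eq_zero_of_mem_inf hm (b - c).2)))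

theorem eZero_ne_zero : eZero p L ≠ 0 := by
  intro h
  have h1 : eZero p L 0 = (Fintype.card L.W : CycField p)⁻¹ := by
    have h2 : ∀ s : Finset L.W, (∑ w ∈ s, of p φ (w : V)) 0 = ∑ w ∈ s, of p φ (w : V) 0 := by
      intro s
      exact Finset.sum_apply (M := fun _ => CycField p) _ _ _
    rw [eZero, SympAlg.smul_apply, h2, Finset.sum_eq_single 0]
    · rw [of_apply, if_pos (show (0 : V) = ((0 : L.W) : V) from rfl), mul_one]
    · intro w _ hw
      rw [of_apply, if_neg fun e => hw (Subtype.ext e.symm)]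
    · intro hh; exact absurd (Finset.mem_univ _) hh
  rw [h, SympAlg.zero_apply] at h1
  exact inv_ne_zero card_W_ne_zero h1.symm

theorem eUnit_ne_zero (a b : L.Wst) : eUnit p L a b ≠ 0 := by
  intro h
  apply eZero_ne_zero (p := p) (L := L)
  have h1 : ∀ x : V, of p φ x * of p φ (-x) = 1 := fun x => by
    rw [of_mul_of, factor_eq_one (by simp [φ.alt x]), one_smul, add_neg_cancel]; rfl
  have h2 : of p φ (a : V) * eUnit p L a b * of p φ (-b : V) = eZero p L := by
    have : of p φ (a : V) * eUnit p L a b * of p φ (-b : V) =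
        (of p φ (a : V) * of p φ (-a : V)) * eZero p L * (of p φ (b : V) * of p φ (-b : V)) := by
      rw [eUnit]; simp only [mul_assoc]
    rw [this, h1, h1, one_mul, mul_one]
  rw [← h2, h, mul_zero, zero_mul]

/-- The linear map `M ↦ ∑_{a,b} M_{ab} e_{ab}`. -/
def ofMatrixLin : Matrix L.Wst L.Wst (CycField p) →ₗ[CycField p] SympAlg p φ where
  toFun M := ∑ a, ∑ b, M a b • eUnit p L a b
  map_add' M N := by simp only [Matrix.add_apply, add_smul, Finset.sum_add_distrib]
  map_smul' c M := by
    simp only [Matrix.smul_apply, smul_eq_mul, mul_smul, Finset.smul_sum, RingHom.id_apply]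

theorem ofMatrixLin_apply (M : Matrix L.Wst L.Wst (CycField p)) :
    ofMatrixLin M = ∑ a, ∑ b, M a b • eUnit p L a b := rfl

theorem ofMatrixLin_mul (hp : p ≠ 2) (M N : Matrix L.Wst L.Wst (CycField p)) :
    ofMatrixLin (M * N) = ofMatrixLin M * ofMatrixLin N := by
  have h : ∀ a b c : L.Wst, (M a b • eUnit p L a b) * (∑ d, N c d • eUnit p L c d) =
      if b = c then ∑ d, (M a b * N c d) • eUnit p L a d else 0 := by
    intro a b c
    simp only [Finset.mul_sum, smul_mul_smul_comm, eUnit_mul_eUnit hp]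
    split_ifs with hbc
    · rfl
    · simp
  simp only [ofMatrixLin_apply, Finset.sum_mul]
  refine Finset.sum_congr rfl fun a _ => ?_
  simp only [Finset.mul_sum (s := Finset.univ) (f := fun c => ∑ d, N c d • eUnit p L c d), h,
    Finset.sum_ite_eq, Finset.mem_univ, if_true]
  rw [Finset.sum_comm]
  refine Finset.sum_congr rfl fun d _ => ?_
  rw [Matrix.mul_apply, Finset.sum_smul]

theorem ofMatrixLin_injective (hp : p ≠ 2) :
    Function.Injective (ofMatrixLin (p := p) (L := L)) := by
  rw [injective_iff_map_eq_zero]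
  intro M hM
  ext a b
  have h : eUnit p L a a * ofMatrixLin M * eUnit p L b b = M a b • eUnit p L a b := by
    simp only [ofMatrixLin_apply, Finset.mul_sum, Finset.sum_mul, mul_smul_comm, smul_mul_assoc,
      eUnit_mul_eUnit hp, ite_mul, zero_mul, smul_ite, smul_zero]
    simp
  rw [hM, mul_zero, zero_mul] at h
  exact (smul_eq_zero.mp h.symm).resolve_right (eUnit_ne_zero a b)

theorem finrank_matrix :
    finrank (CycField p) (Matrix L.Wst L.Wst (CycField p)) =
      finrank (CycField p) (SympAlg p φ) := by
  have h1 : finrank (CycField p) (SympAlg p φ) = Fintype.card V :=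
    finrank_fintype_fun_eq_card (CycField p)
  rw [h1, Module.finrank_matrix, finrank_self, mul_one, Module.card_eq_pow_finrank (K := F),
    Module.card_eq_pow_finrank (K := F) (V := V), ← two_mul_finrank L.lagrangian_st, two_mul,
    pow_add]

theorem ofMatrixLin_bijective (hp : p ≠ 2) :
    Function.Bijective (ofMatrixLin (p := p) (L := L)) := by
  have : Module.Finite (CycField p) (SympAlg p φ) :=
    inferInstanceAs (Module.Finite (CycField p) (V → CycField p))
  exact ⟨ofMatrixLin_injective hp,
    (LinearMap.injective_iff_surjective_of_finrank_eq_finrank finrank_matrix).mp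
      (ofMatrixLin_injective hp)⟩

theorem ofMatrixLin_one (hp : p ≠ 2) : ofMatrixLin (p := p) (L := L) 1 = 1 := by
  obtain ⟨M, hM⟩ := (ofMatrixLin_bijective (p := p) (L := L) hp).2 1
  rw [← mul_one (ofMatrixLin 1), ← hM, ← ofMatrixLin_mul hp, one_mul]

end MatrixUnits

/-- The identification of the full matrix ring (indexed by `W*`) with the symplectic algebra by
means of the matrix units: `M ↦ ∑_{a,b} M_{ab} e_{ab}`. -/
def ofMatrix (hp : p ≠ 2) : Matrix L.Wst L.Wst (CycField p) ≃ₐ[CycField p] SympAlg p φ :=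
  AlgEquiv.ofBijective
    (AlgHom.ofLinearMap ofMatrixLin (ofMatrixLin_one hp) (ofMatrixLin_mul hp))
    (ofMatrixLin_bijective hp)

/-- The matrix `[a]` of an element `a` of the symplectic algebra: `a = ∑_{a,b} [a]_{ab} e_{ab}`. -/
def toMatrix (hp : p ≠ 2) (a : SympAlg p φ) : Matrix L.Wst L.Wst (CycField p) :=
  (ofMatrix p L hp).symm a

/-! ## The Weil representation -/

variable {p} {L}

/-- `P` is a half system: `W*` is the disjoint union of `P`, `-P` and `{0}`. -/
structure IsHalfSystem (P : Set L.Wst) : Prop where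
  zero_notMem : (0 : L.Wst) ∉ P
  mem_or_neg_mem : ∀ a : L.Wst, a ≠ 0 → a ∈ P ∨ -a ∈ P
  not_both : ∀ a : L.Wst, ¬ (a ∈ P ∧ -a ∈ P)

/-- The block `A - B` of a matrix, where `A` is the block with rows and columns in `P` and `B`
is the block with rows in `P` and columns in `-P` (listed in the order of `P`). -/
def flat (P : Set L.Wst) (M : Matrix L.Wst L.Wst (CycField p)) : Matrix P P (CycField p) :=
  Matrix.of fun a b => M a b - M a (-(b : L.Wst))

variable (p) (L)

/-- The normalizing scalar `η(g) = (det s(g)^♭)² (det s(g))⁻¹`. -/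
def eta (hp : p ≠ 2) (P : Set L.Wst) (g : Sp φ) : CycField p :=
  (flat P (toMatrix p L hp (spin p g))).det ^ 2 * (toMatrix p L hp (spin p g)).det⁻¹

/-- The Weil representation `t(g) = η(g) s(g)`. -/
def weilRep (hp : p ≠ 2) (P : Set L.Wst) (g : Sp φ) : SympAlg p φ :=
  eta p L hp P g • spin p g

/-- The Weil character `ω(g) = tr [t(g)]`. -/
def weilCharacter (hp : p ≠ 2) (P : Set L.Wst) (g : Sp φ) : CycField p :=
  (toMatrix p L hp (weilRep p L hp P g)).trace

end

end WeilRep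

namespace WeilRep

set_option linter.unusedSectionVars false

noncomputable section

open scoped Classical
open Module SympAlg

variable {p : ℕ} [Fact p.Prime] {F : Type*} [Field F] [Fintype F] [Algebra (ZMod p) F]

/-! ## Quadratic Gauss sums -/

theorem ringChar_ne_two (hp : p ≠ 2) : ringChar F ≠ 2 := by
  have : CharP F p := charP_of_injective_algebraMap (algebraMap (ZMod p) F).injective p
  rwa [ringChar.eq F p]

theorem psi_ne_one : psi p (F := F) ≠ 1 := by
  obtain ⟨a, ha⟩ := exists_psi_ne_one (p := p) (F := F)
  exact fun h => ha (by rw [h]; rfl)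

theorem sum_psi_eq_zero : ∑ x : F, psi p x = 0 := AddChar.sum_eq_zero_of_ne_one psi_ne_one

theorem sum_psi_mul_eq_zero {a : F} (ha : a ≠ 0) : ∑ x : F, psi p (a * x) = 0 := by
  rw [← sum_psi_eq_zero (p := p) (F := F)]
  exact Fintype.sum_equiv (Equiv.mulLeft₀ a ha) _ _ fun x => rfl

theorem chi_mul (a b : F) : chi p (a * b) = chi p a * chi p b := by
  rw [chi, chi, chi, map_mul, Int.cast_mul]

theorem chi_sq {a : F} (ha : a ≠ 0) : chi p a ^ 2 = 1 := by
  rw [chi, ← Int.cast_pow, quadraticChar_sq_one ha, Int.cast_one]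

theorem chi_one : chi p (1 : F) = 1 := by simp [chi]

theorem inv_chi {a : F} (ha : a ≠ 0) : (chi p a)⁻¹ = chi p a :=
  inv_eq_of_mul_eq_one_left (by rw [← sq, chi_sq ha])

theorem chi_sq_mul {a : F} (ha : a ≠ 0) (b : F) : chi p (a ^ 2 * b) = chi p b := by
  rw [sq, chi_mul, chi_mul, ← sq, chi_sq ha, one_mul]

theorem sum_comp_sq (hp : p ≠ 2) (f : F → CycField p) :
    ∑ x : F, f (x ^ 2) = ∑ y : F, (chi p y + 1) * f y := by
  rw [← Finset.sum_fiberwise Finset.univ (fun x : F => x ^ 2)]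
  refine Finset.sum_congr rfl fun y _ => ?_
  rw [Finset.sum_congr rfl (g := fun _ => f y) fun x hx => by rw [(Finset.mem_filter.mp hx).2],
    Finset.sum_const, nsmul_eq_mul]
  congr 1
  have h := quadraticChar_card_sqrts (ringChar_ne_two (F := F) hp) y
  rw [chi, ← Int.cast_one, ← Int.cast_add, ← h, Int.cast_natCast]
  congr 2
  ext x
  simp

theorem sum_psi_mul_sq_eq_sum (hp : p ≠ 2) {a : F} (ha : a ≠ 0) :
    ∑ x : F, psi p (a * x ^ 2) = ∑ y : F, chi p y * psi p (a * y) := by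
  rw [sum_comp_sq hp fun y => psi p (a * y)]
  simp only [add_mul, one_mul, Finset.sum_add_distrib, sum_psi_mul_eq_zero ha, add_zero]

theorem sum_psi_mul_sq (hp : p ≠ 2) {a : F} (ha : a ≠ 0) :
    ∑ x : F, psi p (a * x ^ 2) = chi p a * rho p F := by
  have h1 := sum_psi_mul_sq_eq_sum hp (one_ne_zero (α := F))
  simp only [one_mul] at h1
  rw [rho, h1, sum_psi_mul_sq_eq_sum hp ha, Finset.mul_sum]
  refine Fintype.sum_equiv (Equiv.mulLeft₀ a ha) _ _ fun x => ?_
  change _ = chi p a * (chi p (a * x) * psi p (a * x))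
  rw [chi_mul, ← mul_assoc, ← mul_assoc, ← sq, chi_sq ha, one_mul]

/-- A Gauss sum with a linear term, evaluated by completing the square. -/
theorem sum_psi_quadratic (hp : p ≠ 2) {a : F} (ha : a ≠ 0) (b : F) :
    ∑ x : F, psi p (a * x ^ 2 + 2 * b * x) = chi p a * rho p F * psi p (-(b ^ 2 / a)) := by
  rw [← sum_psi_mul_sq hp ha, Finset.sum_mul]
  refine Fintype.sum_equiv (Equiv.addRight (b / a)) _ _ fun x => ?_
  rw [Equiv.coe_addRight, ← AddChar.map_add_eq_mul]
  congr 1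
  field_simp
  ring

/-! ## Coefficients of the symplectic algebra -/

variable {V : Type*} [AddCommGroup V] [Module F V] [Fintype V] {φ : SymplecticForm F V}

theorem sum_apply {ι : Type*} (s : Finset ι) (a : ι → SympAlg p φ) (z : V) :
    (∑ i ∈ s, a i) z = ∑ i ∈ s, a i z :=
  Finset.sum_apply (M := fun _ => CycField p) _ _ _

theorem eq_sum_of (a : SympAlg p φ) : a = ∑ x : V, a x • of p φ x := by
  refine ext' fun z => ?_
  rw [sum_apply, Finset.sum_eq_single z]
  · rw [SympAlg.smul_apply, of_apply, if_pos rfl, mul_one]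
  · intro x _ hx
    rw [SympAlg.smul_apply, of_apply, if_neg hx.symm, mul_zero]
  · exact fun h => absurd (Finset.mem_univ _) h

theorem mul_of_apply (a : SympAlg p φ) (x z : V) :
    (a * of p φ x) z = a (z - x) * factor p φ (z - x) x := by
  rw [SympAlg.mul_apply, Finset.sum_eq_single (z - x)]
  · rw [sub_sub_cancel, of_apply, if_pos rfl, mul_one]
  · intro y _ hy
    rw [of_apply, if_neg, mul_zero, zero_mul]
    exact fun h => hy (by rw [← h]; abel)
  · exact fun h => absurd (Finset.mem_univ _) h

theorem one_apply_zero : (1 : SympAlg p φ) 0 = 1 := by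
  rw [one_def, of_apply, if_pos rfl]

theorem mul_apply_zero (a b : SympAlg p φ) : (a * b) 0 = ∑ x : V, a x * b (-x) := by
  rw [SympAlg.mul_apply]
  refine Finset.sum_congr rfl fun x _ => ?_
  rw [zero_sub, factor_eq_one (by simp [φ.alt x]), mul_one]

theorem of_mul_of_neg (x : V) : of p φ x * of p φ (-x) = 1 := by
  rw [of_mul_of, factor_eq_one (by simp [φ.alt x]), one_smul, add_neg_cancel, one_def]

theorem of_mul_of_comm (x y : V) :
    of p φ x * of p φ y = psi p (2 * φ.form x y) • (of p φ y * of p φ x) := by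
  rw [of_mul_of, of_mul_of, smul_smul, add_comm y x, factor, factor, ← AddChar.map_add_eq_mul,
    ← φ.neg_swap x y]
  congr 2
  ring

theorem exists_form_eq {x : V} (hx : x ≠ 0) (α : F) : ∃ y, φ.form y x = α := by
  obtain ⟨w, h⟩ : ∃ w, φ.form w x ≠ 0 := by
    by_contra! h
    exact hx (φ.nondegenerate.2 x h)
  exact ⟨(α / φ.form w x) • w, by simp [h]⟩

theorem exists_psi_two_mul_form_ne_one (hp : p ≠ 2) {x : V} (hx : x ≠ 0) :
    ∃ y, psi p (2 * φ.form y x) ≠ 1 := by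
  obtain ⟨α, hα⟩ := exists_psi_ne_one (p := p) (F := F)
  obtain ⟨y, hy⟩ := exists_form_eq (φ := φ) hx (α / 2)
  exact ⟨y, by rwa [hy, mul_div_cancel₀ _ (two_ne_zero_of_odd p F hp)]⟩

/-- The symplectic algebra is central. -/
theorem eq_smul_one_of_commute (hp : p ≠ 2) {a : SympAlg p φ}
    (h : ∀ x, of p φ x * a = a * of p φ x) : a = a 0 • 1 := by
  refine ext' fun z => ?_
  rw [SympAlg.smul_apply, one_def, of_apply]
  split_ifs with hz
  · rw [hz, mul_one]
  · obtain ⟨y, hy⟩ := exists_psi_two_mul_form_ne_one (p := p) (φ := φ) hp hz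
    have h1 := congrArg (fun b : SympAlg p φ => b (z + y)) (h y)
    simp only [of_mul_apply, mul_of_apply, add_sub_cancel_right] at h1
    rw [mul_zero]
    by_contra ha
    have h2 := mul_left_cancel₀ ha h1
    apply hy
    rw [two_mul, AddChar.map_add_eq_mul]
    change factor p φ y z * factor p φ y z = 1
    nth_rw 2 [h2]
    exact factor_mul_swap y z

/-! ## The elements `s(g)` -/

theorem subOne_apply (g : Sp φ) (x : V) : subOne g x = (g : V ≃ₗ[F] V) x - x := rfl

theorem form_map (g : Sp φ) (x y : V) :
    φ.form ((g : V ≃ₗ[F] V) x) ((g : V ≃ₗ[F] V) y) = φ.form x y := g.2 x y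

theorem thetaQuad_rangeRestrict (g : Sp φ) (x : V) :
    thetaQuad g ((subOne g).rangeRestrict x) = φ.form (subOne g x) x := theta_apply g x x

theorem spin_apply_coe (g : Sp φ) (y : moved g) :
    spin p g (y : V) = psi p (thetaQuad g y) := by
  rw [spin, sum_apply, Finset.sum_eq_single y]
  · rw [SympAlg.smul_apply, of_apply, if_pos rfl, mul_one]
  · intro z _ hz
    rw [SympAlg.smul_apply, of_apply, if_neg fun h => hz (Subtype.ext h.symm), mul_zero]
  · exact fun h => absurd (Finset.mem_univ _) h

theorem spin_apply_subOne (g : Sp φ) (x : V) :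
    spin p g (subOne g x) = psi p (φ.form (subOne g x) x) := by
  rw [← thetaQuad_rangeRestrict, ← spin_apply_coe]
  rfl

theorem spin_apply_of_notMem (g : Sp φ) {z : V} (hz : z ∉ moved g) : spin p g z = 0 := by
  rw [spin, sum_apply]
  refine Finset.sum_eq_zero fun y _ => ?_
  rw [SympAlg.smul_apply, of_apply, if_neg fun h : z = y => hz (h ▸ y.2), mul_zero]

theorem spin_apply_zero (g : Sp φ) : spin p g 0 = 1 := by
  have h := spin_apply_subOne (p := p) g 0
  rwa [map_zero, map_zero, AddChar.map_zero_eq_one] at h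

theorem spin_apply_neg (g : Sp φ) (z : V) : spin p g (-z) = spin p g z := by
  by_cases hz : z ∈ moved g
  · obtain ⟨x, rfl⟩ := hz
    rw [← map_neg, spin_apply_subOne, spin_apply_subOne]
    simp
  · rw [spin_apply_of_notMem g hz, spin_apply_of_notMem g fun h => hz (by simpa using h)]

theorem of_mul_spin (g : Sp φ) (x : V) :
    of p φ x * spin p g = spin p g * of p φ ((g : V ≃ₗ[F] V) x) := by
  refine ext' fun z => ?_
  rw [of_mul_apply, mul_of_apply]
  by_cases hz : z - x ∈ moved g
  · obtain ⟨w, hw⟩ := hz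
    have h1 : z - (g : V ≃ₗ[F] V) x = subOne g (w - x) := by
      rw [map_sub, hw, subOne_apply]
      abel
    rw [← hw, h1, spin_apply_subOne, spin_apply_subOne, factor, factor,
      ← AddChar.map_add_eq_mul, ← AddChar.map_add_eq_mul]
    congr 1
    simp only [subOne_apply, map_sub, LinearMap.sub_apply, form_map, φ.alt w, φ.alt x]
    linear_combination 2 * φ.neg_swap x w - φ.neg_swap x ((g : V ≃ₗ[F] V) w)
      - φ.neg_swap w ((g : V ≃ₗ[F] V) x) + φ.neg_swap x ((g : V ≃ₗ[F] V) x)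
  · rw [spin_apply_of_notMem g hz, spin_apply_of_notMem g, zero_mul, zero_mul]
    rintro ⟨w, hw⟩
    refine hz ⟨w + x, ?_⟩
    rw [map_add, hw, subOne_apply]
    abel

theorem subOne_inv (g : Sp φ) (x : V) : subOne g⁻¹ (-(g : V ≃ₗ[F] V) x) = subOne g x := by
  rw [map_neg, subOne_apply, subOne_apply]
  have : ((g⁻¹ : Sp φ) : V ≃ₗ[F] V) ((g : V ≃ₗ[F] V) x) = x :=
    (g : V ≃ₗ[F] V).symm_apply_apply x
  rw [this]
  abel

theorem spin_mul_spin_inv (hp : p ≠ 2) (g : Sp φ) :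
    spin p g * spin p g⁻¹ = (Fintype.card (moved g) : CycField p) • 1 := by
  have h1 : (spin p g * spin p g⁻¹) 0 = (Fintype.card (moved g) : CycField p) := by
    have h2 : ∀ x : V, spin p g x * spin p g⁻¹ (-x) = if x ∈ moved g then 1 else 0 := by
      intro x
      split_ifs with hx
      · obtain ⟨y, rfl⟩ := hx
        rw [spin_apply_neg, spin_apply_subOne]
        nth_rw 2 [← subOne_inv]
        rw [spin_apply_subOne, subOne_inv, ← AddChar.map_add_eq_mul, ← map_add,
          ← sub_eq_add_neg, ← neg_sub, ← subOne_apply, map_neg, φ.alt, neg_zero,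
          AddChar.map_zero_eq_one]
      · rw [spin_apply_of_notMem g hx, zero_mul]
    rw [mul_apply_zero, Finset.sum_congr rfl fun x _ => h2 x, Finset.sum_boole,
      Fintype.card_subtype]
  rw [← h1]
  refine eq_smul_one_of_commute hp fun x => ?_
  rw [← mul_assoc, of_mul_spin, mul_assoc, of_mul_spin, mul_assoc]
  congr 3
  exact (g : V ≃ₗ[F] V).symm_apply_apply x

theorem card_moved_ne_zero (g : Sp φ) : (Fintype.card (moved g) : CycField p) ≠ 0 :=
  Nat.cast_ne_zero.mpr Fintype.card_ne_zero

theorem moved_inv (g : Sp φ) : moved g⁻¹ = moved g := by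
  have h : ∀ g : Sp φ, moved g ≤ moved g⁻¹ := by
    rintro g _ ⟨x, rfl⟩
    exact ⟨_, subOne_inv g x⟩
  exact le_antisymm (by simpa using h g⁻¹) (h g)

theorem isUnit_spin (hp : p ≠ 2) (g : Sp φ) : IsUnit (spin p g) := by
  have h : ∀ g : Sp φ, spin p g * ((Fintype.card (moved g) : CycField p)⁻¹ • spin p g⁻¹) = 1 :=
    fun g => by
      rw [mul_smul_comm, spin_mul_spin_inv hp, inv_smul_smul₀ (card_moved_ne_zero g)]
  have h' : ((Fintype.card (moved g) : CycField p)⁻¹ • spin p g⁻¹) * spin p g = 1 := by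
    have := h g⁻¹
    simp only [moved_inv, inv_inv] at this
    rwa [mul_smul_comm, ← smul_mul_assoc] at this
  exact ⟨⟨_, _, h g, h'⟩, rfl⟩

/-- Up to scalars, `s(g)` is the only element inducing the action of `g` on `V`. -/
theorem eq_smul_spin (hp : p ≠ 2) (g : Sp φ) {a : SympAlg p φ}
    (h : ∀ x, of p φ x * a = a * of p φ ((g : V ≃ₗ[F] V) x)) : a = a 0 • spin p g := by
  have h1 : a * spin p g⁻¹ = (a * spin p g⁻¹) 0 • 1 := by
    refine eq_smul_one_of_commute hp fun x => ?_
    rw [← mul_assoc, h, mul_assoc, of_mul_spin, mul_assoc]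
    congr 3
    exact (g : V ≃ₗ[F] V).symm_apply_apply x
  have h2 : spin p g⁻¹ * spin p g = (Fintype.card (moved g) : CycField p) • 1 := by
    have := spin_mul_spin_inv (p := p) hp g⁻¹
    simp only [moved_inv, inv_inv] at this
    exact this
  obtain ⟨c, hc⟩ : ∃ c : CycField p, a = c • spin p g := by
    refine ⟨(Fintype.card (moved g) : CycField p)⁻¹ * (a * spin p g⁻¹) 0, ?_⟩
    rw [mul_smul, ← one_mul (spin p g), ← smul_mul_assoc ((a * spin p g⁻¹) 0), ← h1, mul_assoc,
      h2, mul_smul_comm, mul_one, inv_smul_smul₀ (card_moved_ne_zero g)]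
  have h3 : a 0 = c := by rw [hc, SympAlg.smul_apply, spin_apply_zero, mul_one]
  rw [h3, ← hc]

theorem eq_spin_iff (hp : p ≠ 2) (g : Sp φ) (s : SympAlg p φ) :
    (IsUnit s ∧ s 0 = 1 ∧ ∀ x : V, of p φ x * s = s * of p φ ((g : V ≃ₗ[F] V) x)) ↔
      s = spin p g := by
  constructor
  · rintro ⟨-, h0, h⟩
    rw [eq_smul_spin hp g h, h0, one_smul]
  · rintro rfl
    exact ⟨isUnit_spin hp g, spin_apply_zero g, of_mul_spin g⟩

theorem spin_mul_spin (hp : p ≠ 2) (g h : Sp φ) :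
    spin p g * spin p h = (spin p g * spin p h) 0 • spin p (h * g) := by
  refine eq_smul_spin hp (h * g) fun x => ?_
  rw [← mul_assoc, of_mul_spin, mul_assoc, of_mul_spin, mul_assoc]
  rfl

theorem spin_mul_spin_apply_zero_ne_zero (hp : p ≠ 2) (g h : Sp φ) :
    (spin p g * spin p h) 0 ≠ 0 := by
  intro h0
  have h1 := (isUnit_spin (p := p) hp g).mul (isUnit_spin hp h)
  rw [spin_mul_spin hp, h0, zero_smul] at h1
  have h2 : (1 : SympAlg p φ) = 0 := by
    obtain ⟨u, hu⟩ := h1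
    rw [← u.mul_inv, hu, zero_mul]
  have h3 := one_apply_zero (p := p) (φ := φ)
  rw [h2, SympAlg.zero_apply] at h3
  exact zero_ne_one h3

theorem spin_one (hp : p ≠ 2) : spin p (1 : Sp φ) = 1 := by
  refine ((eq_spin_iff hp 1 1).mp ⟨isUnit_one, one_apply_zero, fun x => ?_⟩).symm
  rw [mul_one, one_mul]
  rfl

variable {L : LagrangianPair φ}

/-! ## Matrices and the multiplicativity of `t` -/

theorem toMatrix_mul (hp : p ≠ 2) (a b : SympAlg p φ) :
    toMatrix p L hp (a * b) = toMatrix p L hp a * toMatrix p L hp b :=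
  map_mul (ofMatrix p L hp).symm a b

theorem toMatrix_smul (hp : p ≠ 2) (c : CycField p) (a : SympAlg p φ) :
    toMatrix p L hp (c • a) = c • toMatrix p L hp a :=
  map_smul (ofMatrix p L hp).symm c a

theorem toMatrix_one (hp : p ≠ 2) : toMatrix p L hp (1 : SympAlg p φ) = 1 :=
  map_one (ofMatrix p L hp).symm

theorem ofMatrixLin_toMatrix (hp : p ≠ 2) (a : SympAlg p φ) :
    ofMatrixLin (toMatrix p L hp a) = a :=
  (ofMatrix p L hp).apply_symm_apply a

theorem toMatrix_eq_of (hp : p ≠ 2) {a : SympAlg p φ} {M : Matrix L.Wst L.Wst (CycField p)}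
    (h : ofMatrixLin M = a) : toMatrix p L hp a = M :=
  ofMatrixLin_injective hp (by rw [h, ofMatrixLin_toMatrix])

theorem eZero_apply_neg (z : V) : eZero p L (-z) = eZero p L z := by
  simp only [eZero, SympAlg.smul_apply, sum_apply]
  congr 1
  refine Fintype.sum_equiv (Equiv.neg L.W) _ _ fun w => ?_
  simp only [of_apply, Equiv.neg_apply, NegMemClass.coe_neg, neg_eq_iff_eq_neg]

theorem eUnit_apply (a b : L.Wst) (z : V) :
    eUnit p L a b z = eZero p L (z - b + a) * factor p φ (-a) (z - b + a) *
      factor p φ (z - b) b := by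
  rw [eUnit, mul_of_apply, of_mul_apply, sub_neg_eq_add]

theorem factor_neg_neg (x y : V) : factor p φ (-x) (-y) = factor p φ x y := by
  simp [factor]

theorem eUnit_neg_neg_apply (a b : L.Wst) (z : V) :
    eUnit p L (-a) (-b) z = eUnit p L a b (-z) := by
  rw [eUnit_apply, eUnit_apply, ← eZero_apply_neg, ← factor_neg_neg, ← factor_neg_neg (z - _)]
  simp only [NegMemClass.coe_neg, neg_neg]
  congr 3 <;> abel_nf

theorem toMatrix_neg_neg (hp : p ≠ 2) {s : SympAlg p φ} (hs : ∀ z, s (-z) = s z) (a b : L.Wst) :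
    toMatrix p L hp s (-a) (-b) = toMatrix p L hp s a b := by
  have h : toMatrix p L hp s = Matrix.of fun a b => toMatrix p L hp s (-a) (-b) := by
    refine toMatrix_eq_of hp (ext' fun z => ?_)
    rw [← hs]
    nth_rw 2 [← ofMatrixLin_toMatrix (L := L) hp s]
    simp only [ofMatrixLin_apply, sum_apply, SympAlg.smul_apply, Matrix.of_apply]
    refine Fintype.sum_equiv (Equiv.neg _) _ _ fun a => ?_
    refine Fintype.sum_equiv (Equiv.neg _) _ _ fun b => ?_
    change _ = toMatrix p L hp s (-a) (-b) * eUnit p L (-a) (-b) (-z)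
    rw [eUnit_neg_neg_apply, neg_neg]
  nth_rw 2 [h]
  rfl

section HalfSystem

variable {P : Set L.Wst}

@[to_additive]
theorem IsHalfSystem.prod_eq (hP : IsHalfSystem P) {M : Type*} [CommMonoid M] (f : L.Wst → M) :
    ∏ a, f a = f 0 * ((∏ a : P, f a) * ∏ a : P, f (-(a : L.Wst))) := by
  have h : Function.Bijective
      (fun o : Option (P ⊕ P) => o.elim (0 : L.Wst) (Sum.elim (fun a => a) fun a => -a)) := by
    have h0 : ∀ a : P, (a : L.Wst) ≠ 0 := fun a ha => hP.zero_notMem (ha ▸ a.2)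
    have h1 : ∀ a b : P, (a : L.Wst) ≠ -b := fun a b hab => hP.not_both b ⟨b.2, hab ▸ a.2⟩
    constructor
    · rintro (_ | a | a) (_ | b | b) hab
      · rfl
      · exact absurd hab.symm (h0 b)
      · exact absurd (neg_eq_zero.mp hab.symm) (h0 b)
      · exact absurd hab (h0 a)
      · exact congrArg (fun x => some (Sum.inl x)) (Subtype.ext hab)
      · exact absurd hab (h1 a b)
      · exact absurd (neg_eq_zero.mp hab) (h0 a)
      · exact absurd hab.symm (h1 b a)
      · exact congrArg (fun x => some (Sum.inr x)) (Subtype.ext (neg_injective hab))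
    · intro a
      by_cases ha : a = 0
      · exact ⟨none, ha.symm⟩
      rcases hP.mem_or_neg_mem a ha with h | h
      · exact ⟨some (Sum.inl ⟨a, h⟩), rfl⟩
      · exact ⟨some (Sum.inr ⟨-a, h⟩), neg_neg a⟩
  rw [← Fintype.prod_bijective _ h _ f fun _ => rfl, Fintype.prod_option, Fintype.prod_sum_type]
  rfl

theorem IsHalfSystem.card_eq (hP : IsHalfSystem P) :
    Fintype.card L.Wst = 2 * Fintype.card P + 1 := by
  have h := hP.sum_eq fun _ => 1
  simp only [Finset.sum_const, smul_eq_mul, mul_one, Finset.card_univ] at h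
  omega

theorem flat_mul (hP : IsHalfSystem P) (M N : Matrix L.Wst L.Wst (CycField p))
    (hN : ∀ a b, N (-a) (-b) = N a b) : flat P (M * N) = flat P M * flat P N := by
  ext a b
  have hN' : ∀ c d, N (-c) d = N c (-d) := fun c d => by rw [← hN, neg_neg]
  have h0 : N 0 (-(b : L.Wst)) = N 0 b := by rw [← hN', neg_zero]
  simp only [flat, Matrix.of_apply, Matrix.mul_apply, hP.sum_eq, h0, hN', neg_neg,
    ← Finset.sum_add_distrib]
  rw [add_sub_add_left_eq_sub, ← Finset.sum_sub_distrib]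
  exact Finset.sum_congr rfl fun c _ => by ring

theorem flat_smul (c : CycField p) (M : Matrix L.Wst L.Wst (CycField p)) :
    flat P (c • M) = c • flat P M := by
  ext a b
  simp [flat, mul_sub]

theorem flat_diagonal (hP : IsHalfSystem P) (d : L.Wst → CycField p) :
    flat P (Matrix.diagonal d) = Matrix.diagonal fun a : P => d a := by
  ext a b
  have h1 : (a : L.Wst) ≠ -b := fun hab => hP.not_both b ⟨b.2, hab ▸ a.2⟩
  rw [flat, Matrix.of_apply, Matrix.diagonal_apply_ne _ h1, sub_zero]
  simp only [Matrix.diagonal_apply, Subtype.ext_iff]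

theorem flat_one (hP : IsHalfSystem P) :
    flat P (1 : Matrix L.Wst L.Wst (CycField p)) = 1 := by
  rw [← Matrix.diagonal_one, flat_diagonal hP, ← Matrix.diagonal_one]

/-- The normalized determinant `(det M^♭)² / det M` of a nonzero even diagonal matrix. -/
theorem det_flat_diagonal (hP : IsHalfSystem P) {d : L.Wst → CycField p}
    (h0 : ∀ a, d a ≠ 0) (h : ∀ a, d (-a) = d a) :
    (flat P (Matrix.diagonal d)).det ^ 2 * (Matrix.diagonal d).det⁻¹ = (d 0)⁻¹ := by
  rw [flat_diagonal hP, Matrix.det_diagonal, Matrix.det_diagonal, hP.prod_eq]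
  simp only [h]
  have h1 : ∏ a : P, d a ≠ 0 := Finset.prod_ne_zero_iff.mpr fun a _ => h0 a
  have := h0 0
  field_simp

theorem eta_mul (hp : p ≠ 2) (hP : IsHalfSystem P) (g h : Sp φ) :
    eta p L hp P g * eta p L hp P h = ((spin p g * spin p h) 0)⁻¹ * eta p L hp P (h * g) := by
  have h1 := congrArg (toMatrix p L hp) (spin_mul_spin (p := p) hp g h)
  rw [toMatrix_mul, toMatrix_smul] at h1
  set c := (spin p g * spin p h) 0 with hc
  have hc0 : c ≠ 0 := spin_mul_spin_apply_zero_ne_zero hp g h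
  have h2 := congrArg Matrix.det h1
  have h3 := congrArg (fun M => (flat P M).det) h1
  simp only [flat_mul hP _ _ (toMatrix_neg_neg hp (spin_apply_neg h)), flat_smul, Matrix.det_mul,
    Matrix.det_smul] at h3
  rw [Matrix.det_mul, Matrix.det_smul, hP.card_eq] at h2
  have h4 : c ^ (Fintype.card P) ≠ 0 := pow_ne_zero _ hc0
  simp only [eta]
  rw [mul_mul_mul_comm, ← mul_pow, ← mul_inv, h2, h3]
  field_simp
  ring

theorem eta_one (hp : p ≠ 2) (hP : IsHalfSystem P) : eta p L hp P (1 : Sp φ) = 1 := by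
  rw [eta, spin_one hp, toMatrix_one, flat_one hP, Matrix.det_one, Matrix.det_one]
  simp

theorem weilRep_one (hp : p ≠ 2) (hP : IsHalfSystem P) : weilRep p L hp P (1 : Sp φ) = 1 := by
  rw [weilRep, eta_one hp hP, spin_one hp, one_smul]

theorem weilRep_mul (hp : p ≠ 2) (hP : IsHalfSystem P) (g h : Sp φ) :
    weilRep p L hp P (h * g) = weilRep p L hp P g * weilRep p L hp P h := by
  have h1 := spin_mul_spin (p := p) hp g h
  have h2 := eta_mul (L := L) hp hP g h
  have h3 := spin_mul_spin_apply_zero_ne_zero (p := p) hp g h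
  generalize (spin p g * spin p h) 0 = c at h1 h2 h3
  rw [weilRep, weilRep, weilRep, smul_mul_smul_comm, h2, h1, smul_smul, mul_right_comm,
    inv_mul_cancel₀ h3, one_mul]

theorem eta_mul_eta_inv (hp : p ≠ 2) (hP : IsHalfSystem P) (g : Sp φ) :
    eta p L hp P g * eta p L hp P g⁻¹ = (Fintype.card (moved g) : CycField p)⁻¹ := by
  rw [eta_mul hp hP, inv_mul_cancel, eta_one hp hP, mul_one, spin_mul_spin_inv hp,
    SympAlg.smul_apply, one_apply_zero, mul_one]

theorem eta_ne_zero (hp : p ≠ 2) (hP : IsHalfSystem P) (g : Sp φ) : eta p L hp P g ≠ 0 := by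
  intro h
  have := eta_mul_eta_inv (L := L) hp hP g
  rw [h, zero_mul] at this
  exact inv_ne_zero (card_moved_ne_zero g) this.symm

end HalfSystem

theorem trace_toMatrix (hp : p ≠ 2) (a : SympAlg p φ) :
    (toMatrix p L hp a).trace = a 0 * Fintype.card L.Wst := by
  let T : SympAlg p φ →ₗ[CycField p] CycField p :=
    Matrix.traceLinearMap L.Wst (CycField p) (CycField p) ∘ₗ
      (ofMatrix p L hp).symm.toLinearMap
  have hT : ∀ a, T a = (toMatrix p L hp a).trace := fun _ => rfl
  have hT_one : T (of p φ 0) = Fintype.card L.Wst := by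
    rw [hT, ← one_def, toMatrix_one, Matrix.trace_one]
  have hT_of : ∀ x, x ≠ 0 → T (of p φ x) = 0 := by
    intro x hx
    obtain ⟨y, hy⟩ := exists_psi_two_mul_form_ne_one (p := p) (φ := φ) hp hx
    have h1 : T (of p φ y * of p φ x * of p φ (-y)) = T (of p φ x) := by
      rw [hT, toMatrix_mul, Matrix.trace_mul_comm, ← toMatrix_mul, ← mul_assoc]
      nth_rw 2 [← neg_neg y]
      rw [of_mul_of_neg, one_mul, hT]
    rw [of_mul_of_comm, smul_mul_assoc, mul_assoc, of_mul_of_neg, mul_one, map_smul,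
      smul_eq_mul] at h1
    by_contra h0
    exact hy (mul_right_cancel₀ h0 (h1.trans (one_mul _).symm))
  rw [← hT, eq_sum_of a, map_sum, Finset.sum_eq_single 0, map_smul, hT_one, ← eq_sum_of a,
    smul_eq_mul]
  · intro x _ hx
    rw [map_smul, hT_of x hx, smul_zero]
  · exact fun h => absurd (Finset.mem_univ _) h

theorem card_Wst {n : ℕ} (hn : finrank F V = 2 * n) :
    Fintype.card L.Wst = Fintype.card F ^ n := by
  have h := two_mul_finrank L.lagrangian_st
  rw [card_eq_pow_finrank (K := F), show finrank F L.Wst = n by omega]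

theorem weilCharacter_eq (hp : p ≠ 2) {n : ℕ} (hn : finrank F V = 2 * n) (P : Set L.Wst)
    (g : Sp φ) :
    weilCharacter p L hp P g = (Fintype.card F : CycField p) ^ n * eta p L hp P g := by
  rw [weilCharacter, trace_toMatrix, weilRep, SympAlg.smul_apply, spin_apply_zero, mul_one,
    card_Wst hn, Nat.cast_pow, mul_comm]

variable {P : Set L.Wst}

/-! ## Transvections -/

variable (φ) in
/-- The symplectic transvection `x ↦ x + b φ(x, v) v`. -/
def transvec (b : F) (v : V) : Sp φ :=
  ⟨LinearEquiv.transvection (f := b • φ.form.flip v) (v := v) (by simp [φ.alt v]), fun x y => by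
    simp only [LinearEquiv.transvection.apply, LinearMap.smul_apply, LinearMap.BilinForm.flip_apply,
      map_add, map_smul, LinearMap.add_apply, smul_eq_mul, φ.alt v, ← φ.neg_swap y v]
    ring⟩

theorem transvec_apply (b : F) (v x : V) :
    (transvec φ b v : V ≃ₗ[F] V) x = x + (b * φ.form x v) • v := rfl

theorem subOne_transvec (b : F) (v x : V) :
    subOne (transvec φ b v) x = (b * φ.form x v) • v := by
  rw [subOne_apply, transvec_apply, add_sub_cancel_left]

theorem transvec_neg_mul (b : F) (v : V) : transvec φ (-b) v * transvec φ b v = 1 := by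
  refine Subtype.ext (LinearEquiv.ext fun x => ?_)
  change (transvec φ (-b) v : V ≃ₗ[F] V) ((transvec φ b v : V ≃ₗ[F] V) x) = x
  simp only [transvec_apply, map_add, map_smul, φ.alt v]
  module

theorem conj_transvec (k : Sp φ) (b : F) (v : V) :
    k * transvec φ b v * k⁻¹ = transvec φ b ((k : V ≃ₗ[F] V) v) := by
  rw [mul_inv_eq_iff_eq_mul]
  refine Subtype.ext (LinearEquiv.ext fun x => ?_)
  change (k : V ≃ₗ[F] V) ((transvec φ b v : V ≃ₗ[F] V) x) =
    (transvec φ b ((k : V ≃ₗ[F] V) v) : V ≃ₗ[F] V) ((k : V ≃ₗ[F] V) x)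
  rw [transvec_apply, transvec_apply, map_add, map_smul, form_map]

theorem spin_transvec_smul {b : F} (hb : b ≠ 0) {v : V} (hv : v ≠ 0) (l : F) :
    spin p (transvec φ b v) (l • v) = psi p (-b⁻¹ * l ^ 2) := by
  obtain ⟨x, hx⟩ := exists_form_eq (φ := φ) hv (b⁻¹ * l)
  have h : l • v = subOne (transvec φ b v) x := by
    rw [subOne_transvec, hx, mul_inv_cancel_left₀ hb]
  rw [h, spin_apply_subOne, ← h, map_smul, LinearMap.smul_apply, ← φ.neg_swap, hx]
  congr 1
  simp only [smul_eq_mul]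
  ring

theorem spin_transvec {b : F} (hb : b ≠ 0) {v : V} (hv : v ≠ 0) :
    spin p (transvec φ b v) = ∑ l : F, psi p (-b⁻¹ * l ^ 2) • of p φ (l • v) := by
  refine ext' fun z => ?_
  simp only [sum_apply, SympAlg.smul_apply, of_apply]
  by_cases hz : ∃ l : F, z = l • v
  · obtain ⟨l, rfl⟩ := hz
    rw [spin_transvec_smul hb hv, Finset.sum_eq_single l]
    · rw [if_pos rfl, mul_one]
    · intro m _ hm
      rw [if_neg fun h => hm (smul_left_injective F hv h).symm, mul_zero]
    · exact fun h => absurd (Finset.mem_univ _) h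
  · rw [spin_apply_of_notMem]
    · refine (Finset.sum_eq_zero fun l _ => ?_).symm
      rw [if_neg fun h => hz ⟨l, h⟩, mul_zero]
    · rintro ⟨x, rfl⟩
      exact hz ⟨_, subOne_transvec b v x⟩

theorem spin_mul_spin_transvec_apply_zero (g : Sp φ) {b : F} (hb : b ≠ 0) {v : V} (hv : v ≠ 0) :
    (spin p g * spin p (transvec φ b v)) 0 =
      ∑ l : F, psi p (-b⁻¹ * l ^ 2) * spin p g (l • v) := by
  rw [spin_transvec hb hv, Finset.mul_sum, sum_apply]
  refine Finset.sum_congr rfl fun l _ => ?_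
  rw [mul_smul_comm, SympAlg.smul_apply, mul_of_apply, zero_sub, spin_apply_neg,
    factor_eq_one (by simp [φ.alt v]), mul_one]

theorem toMatrix_of_mem_W (hp : p ≠ 2) {w : V} (hw : w ∈ L.W) :
    toMatrix p L hp (of p φ w) =
      Matrix.diagonal fun a : L.Wst => psi p (-(2 * φ.form w a)) := by
  refine toMatrix_eq_of hp ?_
  have h1 : ∀ (d : L.Wst → CycField p),
      ofMatrixLin (Matrix.diagonal d) = ∑ a, d a • eUnit p L a a := by
    intro d
    rw [ofMatrixLin_apply]
    refine Finset.sum_congr rfl fun a _ => ?_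
    rw [Finset.sum_eq_single a]
    · rw [Matrix.diagonal_apply_eq]
    · intro b _ hb
      rw [Matrix.diagonal_apply_ne _ hb.symm, zero_smul]
    · exact fun h => absurd (Finset.mem_univ _) h
  have h2 := ofMatrixLin_one (p := p) (L := L) hp
  rw [← Matrix.diagonal_one, h1] at h2
  rw [h1, ← mul_one (of p φ w), ← h2, Finset.mul_sum]
  refine Finset.sum_congr rfl fun a _ => ?_
  rw [one_smul, eUnit, ← mul_assoc, ← mul_assoc, of_mul_of_comm, smul_mul_assoc, smul_mul_assoc,
    mul_assoc (of p φ _) (of p φ w), of_mul_eZero hw, map_neg (φ.form w), mul_neg]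

theorem toMatrix_spin_transvec (hp : p ≠ 2) {b : F} (hb : b ≠ 0) {v : V} (hv : v ≠ 0)
    (hvW : v ∈ L.W) : toMatrix p L hp (spin p (transvec φ b v)) =
      Matrix.diagonal fun a : L.Wst =>
        chi p (-b⁻¹) * rho p F * psi p (-((-φ.form v a) ^ 2 / (-b⁻¹))) := by
  have h1 : toMatrix p L hp (spin p (transvec φ b v)) =
      ∑ l : F, psi p (-b⁻¹ * l ^ 2) • toMatrix p L hp (of p φ (l • v)) := by
    rw [spin_transvec hb hv]
    simp only [toMatrix, map_sum, map_smul]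
  rw [h1]
  simp only [fun l => toMatrix_of_mem_W (p := p) hp (L.W.smul_mem l hvW)]
  ext a c
  rw [Matrix.sum_apply]
  by_cases hac : a = c
  · subst hac
    simp only [Matrix.smul_apply, Matrix.diagonal_apply_eq, smul_eq_mul]
    rw [← sum_psi_quadratic hp (neg_ne_zero.mpr (inv_ne_zero hb))]
    refine Finset.sum_congr rfl fun l _ => ?_
    rw [← AddChar.map_add_eq_mul, map_smul, LinearMap.smul_apply, smul_eq_mul]
    congr 1
    ring
  · simp only [Matrix.smul_apply, Matrix.diagonal_apply_ne _ hac, smul_zero,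
      Finset.sum_const_zero]

theorem eta_transvec_of_mem (hp : p ≠ 2) (hP : IsHalfSystem P) {b : F} (hb : b ≠ 0) {v : V}
    (hv : v ≠ 0) (hvW : v ∈ L.W) :
    eta p L hp P (transvec φ b v) = (chi p (-b⁻¹) * rho p F)⁻¹ := by
  have h0 : chi p (-b⁻¹) * rho p F ≠ 0 := by
    intro h0
    have h1 := eta_ne_zero hp hP (transvec φ b v)
    rw [eta, toMatrix_spin_transvec hp hb hv hvW, h0, flat_diagonal hP] at h1
    have : Nonempty L.Wst := ⟨0⟩
    simp at h1
  rw [eta, toMatrix_spin_transvec hp hb hv hvW, det_flat_diagonal hP]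
  · simp
  · exact fun a => mul_ne_zero h0 (AddChar.val_isUnit _ _).ne_zero
  · intro a
    simp

theorem eta_conj (hp : p ≠ 2) (hP : IsHalfSystem P) (k g : Sp φ) :
    eta p L hp P (k * g * k⁻¹) = eta p L hp P g := by
  have h : ∀ g : Sp φ, (toMatrix p L hp (weilRep p L hp P g)).trace =
      eta p L hp P g * Fintype.card L.Wst := fun g => by
    rw [trace_toMatrix, weilRep, SympAlg.smul_apply, spin_apply_zero, mul_one]
  have h1 : (Fintype.card L.Wst : CycField p) ≠ 0 := Nat.cast_ne_zero.mpr Fintype.card_ne_zero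
  apply mul_right_cancel₀ h1
  rw [← h, ← h, weilRep_mul hp hP, toMatrix_mul, Matrix.trace_mul_comm, ← toMatrix_mul,
    ← weilRep_mul hp hP, inv_mul_cancel_left]

theorem exists_map_mem_W (v : V) : ∃ k : Sp φ, (k : V ≃ₗ[F] V) v ∈ L.W := by
  by_cases h : v ∈ L.W
  · exact ⟨1, h⟩
  obtain ⟨w, hw, hvw⟩ : ∃ w ∈ L.W, φ.form w v ≠ 0 := by
    by_contra! h'
    exact h (mem_of_orthogonal L.lagrangian h')
  refine ⟨transvec φ (-(φ.form w v)⁻¹) (v - w), ?_⟩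
  have : (transvec φ (-(φ.form w v)⁻¹) (v - w) : V ≃ₗ[F] V) v = w := by
    rw [transvec_apply, map_sub, φ.alt v, zero_sub, φ.neg_swap, neg_mul, inv_mul_cancel₀ hvw,
      neg_one_smul]
    abel
  rwa [this]

theorem eta_transvec (hp : p ≠ 2) (hP : IsHalfSystem P) {b : F} (hb : b ≠ 0) {v : V}
    (hv : v ≠ 0) : eta p L hp P (transvec φ b v) = (chi p (-b⁻¹) * rho p F)⁻¹ := by
  obtain ⟨k, hk⟩ := exists_map_mem_W (L := L) v
  rw [← eta_conj hp hP k, conj_transvec]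
  exact eta_transvec_of_mem hp hP hb (by simpa using hv) hk

/-! ## Theta forms of products with transvections -/

theorem chi_det_toMatrix_eq {M ι κ : Type*} [AddCommGroup M] [Module F M] [Fintype ι]
    [DecidableEq ι] [Fintype κ] [DecidableEq κ] (b : Basis ι F M) (c : Basis κ F M)
    (B : LinearMap.BilinForm F M) :
    chi p (LinearMap.BilinForm.toMatrix b B).det =
      chi p (LinearMap.BilinForm.toMatrix c B).det := by
  let e := c.indexEquiv b
  have h1 : LinearMap.BilinForm.toMatrix (c.reindex e) B =
      (LinearMap.BilinForm.toMatrix c B).submatrix e.symm e.symm := by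
    ext i j
    simp [LinearMap.BilinForm.toMatrix_apply]
  have h2 : (b.toMatrix (c.reindex e)).det ≠ 0 := fun h0 => by
    have h3 := congrArg Matrix.det (b.toMatrix_mul_toMatrix_flip (c.reindex e))
    rw [Matrix.det_mul, h0, zero_mul, Matrix.det_one] at h3
    exact zero_ne_one h3
  rw [← Matrix.det_submatrix_equiv_self e.symm (LinearMap.BilinForm.toMatrix c B), ← h1,
    ← LinearMap.BilinForm.toMatrix_mul_basis_toMatrix b (c.reindex e) B, Matrix.det_mul,
    Matrix.det_mul, Matrix.det_transpose, mul_right_comm, ← sq, chi_sq_mul h2]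

theorem theta_rangeRestrict (g : Sp φ) (u : moved g) (y : V) :
    theta g u ((subOne g).rangeRestrict y) = φ.form (u : V) y := by
  obtain ⟨_, x, rfl⟩ := u
  exact theta_apply g x y

theorem exists_theta_ne_zero (g : Sp φ) {v : moved g} (hv : v ≠ 0) : ∃ u, theta g u v ≠ 0 := by
  by_contra! h
  obtain ⟨_, w, rfl⟩ := v
  apply hv
  refine Subtype.ext (φ.nondegenerate.2 _ fun y => ?_)
  have hw : ∀ x, φ.form ((g : V ≃ₗ[F] V) x) w = φ.form x w := fun x => by
    have h1 := h ((subOne g).rangeRestrict x)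
    rw [show (⟨subOne g w, w, rfl⟩ : moved g) = (subOne g).rangeRestrict w from rfl,
      theta_apply, subOne_apply, map_sub, LinearMap.sub_apply] at h1
    exact sub_eq_zero.mp h1
  obtain ⟨x, rfl⟩ := (g : V ≃ₗ[F] V).surjective y
  change φ.form _ (subOne g w) = 0
  rw [subOne_apply, map_sub, form_map, hw, sub_self]

/-- The endomorphism `u ↦ u - b Θ_g(u, v) v` of `V^{g-1}`. -/
def thetaTransvec (g : Sp φ) (b : F) (v : moved g) : moved g →ₗ[F] moved g :=
  LinearMap.transvection (-b • (theta g).flip v) v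

theorem thetaTransvec_apply (g : Sp φ) (b : F) (v u : moved g) :
    thetaTransvec g b v u = u - (b * theta g u v) • v := by
  change u + (-b * theta g u v) • v = _
  module

theorem subOne_transvec_mul (g : Sp φ) (b : F) (v : moved g) (x : V) :
    subOne (transvec φ b (v : V) * g) x =
      (thetaTransvec g b v ((subOne g).rangeRestrict x) : V) := by
  obtain ⟨_, w, rfl⟩ := v
  change (transvec φ b (subOne g w) : V ≃ₗ[F] V) ((g : V ≃ₗ[F] V) x) - x = _
  rw [thetaTransvec_apply,
    show (⟨subOne g w, w, rfl⟩ : moved g) = (subOne g).rangeRestrict w from rfl, theta_apply,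
    transvec_apply]
  change _ = subOne g x - (b * φ.form (subOne g x) w) • subOne g w
  rw [subOne_apply, subOne_apply, map_sub, form_map, map_sub, LinearMap.sub_apply]
  module

theorem moved_transvec_mul (g : Sp φ) (b : F) (v : moved g) :
    moved (transvec φ b (v : V) * g) =
      (LinearMap.range (thetaTransvec g b v)).map (moved g).subtype := by
  ext z
  simp only [Submodule.mem_map, LinearMap.mem_range, Submodule.subtype_apply]
  constructor
  · rintro ⟨x, rfl⟩
    exact ⟨_, ⟨_, rfl⟩, (subOne_transvec_mul g b v x).symm⟩
  · rintro ⟨_, ⟨⟨_, x, rfl⟩, rfl⟩, rfl⟩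
    exact ⟨x, subOne_transvec_mul g b v x⟩

/-- The image of `g' - 1`, `g' = transvec φ b v * g`, as a subspace of the image of `g - 1`. -/
def movedTransvecMulEquiv (g : Sp φ) (b : F) (v : moved g) :
    LinearMap.range (thetaTransvec g b v) ≃ₗ[F] moved (transvec φ b (v : V) * g) :=
  (Submodule.equivMapOfInjective (moved g).subtype (moved g).injective_subtype _).trans
    (LinearEquiv.ofEq _ _ (moved_transvec_mul g b v).symm)

theorem coe_movedTransvecMulEquiv (g : Sp φ) (b : F) (v : moved g)
    (r : LinearMap.range (thetaTransvec g b v)) :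
    (movedTransvecMulEquiv g b v r : V) = ((r : moved g) : V) := rfl

theorem theta_transvec_mul (g : Sp φ) (b : F) (v : moved g)
    (r r' : LinearMap.range (thetaTransvec g b v)) (u : moved g)
    (hu : thetaTransvec g b v u = r') :
    theta (transvec φ b (v : V) * g) (movedTransvecMulEquiv g b v r)
      (movedTransvecMulEquiv g b v r') = theta g r u := by
  obtain ⟨_, x, rfl⟩ := u
  have h : movedTransvecMulEquiv g b v r' =
      (subOne (transvec φ b (v : V) * g)).rangeRestrict x := by
    refine Subtype.ext ?_
    rw [coe_movedTransvecMulEquiv, ← hu]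
    exact (subOne_transvec_mul g b v x).symm
  rw [h, theta_rangeRestrict, coe_movedTransvecMulEquiv]
  exact (theta_rangeRestrict g r x).symm

theorem thetaQuad_smul (g : Sp φ) (l : F) (v : moved g) :
    thetaQuad g (l • v) = l ^ 2 * theta g v v := by
  rw [QuadraticMap.map_smul, sq, smul_eq_mul]
  rfl

theorem det_theta_transvec_mul_of_isotropic (g : Sp φ) {b : F} {v : moved g}
    (hv : theta g v v = 0) {n : ℕ} (c : Basis (Fin n) F (moved g)) :
    ∃ c' : Basis (Fin n) F (moved (transvec φ b (v : V) * g)),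
      (LinearMap.BilinForm.toMatrix c' (theta (transvec φ b (v : V) * g))).det =
        (LinearMap.BilinForm.toMatrix c (theta g)).det := by
  have hdet : (thetaTransvec g b v).det = 1 := by
    rw [thetaTransvec, LinearMap.transvection.det]
    simp [hv]
  have hinj : Function.Injective (thetaTransvec g b v) := by
    refine (LinearMap.equivOfDetNeZero (thetaTransvec g b v) ?_).injective
    rw [hdet]
    exact one_ne_zero
  refine ⟨c.map ((LinearEquiv.ofInjective _ hinj).trans (movedTransvecMulEquiv g b v)), ?_⟩
  rw [← one_mul (Matrix.det (LinearMap.BilinForm.toMatrix c _)), ← hdet,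
    ← LinearMap.det_toMatrix c, ← Matrix.det_transpose (LinearMap.toMatrix c c _),
    ← Matrix.det_mul, ← LinearMap.BilinForm.toMatrix_compLeft]
  congr 1
  ext i j
  rw [LinearMap.BilinForm.toMatrix_apply, LinearMap.BilinForm.toMatrix_apply, Basis.map_apply,
    Basis.map_apply]
  exact theta_transvec_mul g b v _ _ _ rfl

theorem theta_thetaTransvec_eq_zero (g : Sp φ) {v : moved g} (hv : theta g v v ≠ 0)
    (u : moved g) :
    theta g (thetaTransvec g (theta g v v)⁻¹ v u) v = 0 := by
  rw [thetaTransvec_apply, map_sub, map_smul, LinearMap.sub_apply, LinearMap.smul_apply,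
    smul_eq_mul]
  field_simp
  ring

theorem coe_notMem_moved_transvec_mul (g : Sp φ) {v : moved g} (hv : theta g v v ≠ 0)
    {l : F} (hl : l ≠ 0) :
    l • (v : V) ∉ moved (transvec φ (theta g v v)⁻¹ (v : V) * g) := by
  rw [moved_transvec_mul]
  rintro ⟨_, ⟨u, rfl⟩, hu⟩
  have h1 : thetaTransvec g (theta g v v)⁻¹ v u = l • v := Subtype.ext hu
  have h2 := theta_thetaTransvec_eq_zero g hv u
  rw [h1, map_smul, LinearMap.smul_apply] at h2
  exact smul_ne_zero hl hv h2

theorem det_theta_transvec_mul_of_anisotropic (g : Sp φ) {v : moved g} (hv : theta g v v ≠ 0)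
    {n : ℕ}
    (c : Basis (Fin n) F (moved (transvec φ (theta g v v)⁻¹ (v : V) * g))) :
    ∃ c' : Basis (Fin (n + 1)) F (moved g),
      (LinearMap.BilinForm.toMatrix c' (theta g)).det = theta g v v *
        (LinearMap.BilinForm.toMatrix c
          (theta (transvec φ (theta g v v)⁻¹ (v : V) * g))).det := by
  let E := movedTransvecMulEquiv g (theta g v v)⁻¹ v
  have hr : ∀ r : LinearMap.range (thetaTransvec g (theta g v v)⁻¹ v),
      theta g (r : moved g) v = 0 := by
    rintro ⟨_, u, rfl⟩
    exact theta_thetaTransvec_eq_zero g hv u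
  have hRr : ∀ r : LinearMap.range (thetaTransvec g (theta g v v)⁻¹ v),
      thetaTransvec g (theta g v v)⁻¹ v r = r := fun r => by
    rw [thetaTransvec_apply, hr, mul_zero, zero_smul, sub_zero]
  let c₀ := c.map E.symm
  have hc₀ : ∀ i, c i = E (c₀ i) := fun i => by simp [c₀]
  refine ⟨Basis.mkFinCons v c₀ ?_ ?_, ?_⟩
  · intro a x hx hax
    have h1 := congrArg (fun u => theta g u v) hax
    simp only [map_add, map_smul, LinearMap.add_apply, LinearMap.smul_apply, hr ⟨x, hx⟩, add_zero,
      map_zero, LinearMap.zero_apply] at h1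
    exact (smul_eq_zero.mp h1).resolve_right hv
  · intro z
    refine ⟨-((theta g v v)⁻¹ * theta g z v), z, ?_⟩
    rw [thetaTransvec_apply, neg_smul, sub_eq_add_neg]
  · rw [Matrix.det_succ_column_zero, Fin.sum_univ_succ, Finset.sum_eq_zero, add_zero]
    · simp only [LinearMap.BilinForm.toMatrix_apply, Basis.coe_mkFinCons, Fin.val_zero, pow_zero,
        one_mul, Fin.cons_zero]
      congr 2
      ext i j
      rw [Matrix.submatrix_apply, LinearMap.BilinForm.toMatrix_apply,
        LinearMap.BilinForm.toMatrix_apply, Basis.coe_mkFinCons, Fin.succAbove_zero, Fin.cons_succ,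
        Fin.cons_succ, hc₀, hc₀]
      exact (theta_transvec_mul g _ v _ _ _ (hRr _)).symm
    · intro i _
      rw [LinearMap.BilinForm.toMatrix_apply, Basis.coe_mkFinCons, Fin.cons_succ, Fin.cons_zero,
        Function.comp_apply, hr, mul_zero, zero_mul]

/-! ## The formula for `η` -/

/-- The formula `η(g) = ρ^{-dim V^{g-1}} χ(det Θ_g)`, with respect to some basis. -/
def EtaFormula (hp : p ≠ 2) (P : Set L.Wst) (g : Sp φ) : Prop :=
  ∃ (n : ℕ) (b : Basis (Fin n) F (moved g)), eta p L hp P g =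
    (rho p F ^ n)⁻¹ * chi p (LinearMap.BilinForm.toMatrix b (theta g)).det

theorem EtaFormula.eq {hp : p ≠ 2} {g : Sp φ} (h : EtaFormula hp P g) {ι : Type*} [Fintype ι]
    [DecidableEq ι] (b : Basis ι F (moved g)) : eta p L hp P g =
      (rho p F ^ Fintype.card ι)⁻¹ * chi p (LinearMap.BilinForm.toMatrix b (theta g)).det := by
  obtain ⟨n, c, hc⟩ := h
  rw [hc, chi_det_toMatrix_eq b c, ← finrank_eq_card_basis b, finrank_eq_card_basis c,
    Fintype.card_fin]

theorem etaFormula_of_anisotropic (hp : p ≠ 2) (hP : IsHalfSystem P) (g : Sp φ) {v : moved g}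
    (hv : theta g v v ≠ 0)
    (h : EtaFormula hp P (transvec φ (theta g v v)⁻¹ (v : V) * g)) : EtaFormula hp P g := by
  obtain ⟨n, c, hc⟩ := h
  obtain ⟨c', hc'⟩ := det_theta_transvec_mul_of_anisotropic g hv c
  have hv0 : (v : V) ≠ 0 := fun h0 => hv (by rw [show v = 0 from Subtype.ext h0, map_zero])
  have hb : -(theta g v v)⁻¹ ≠ 0 := neg_ne_zero.mpr (inv_ne_zero hv)
  refine ⟨n + 1, c', ?_⟩
  set h := transvec φ (theta g v v)⁻¹ (v : V) * g with hh
  have hg : transvec φ (-(theta g v v)⁻¹) (v : V) * h = g := by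
    rw [hh, ← mul_assoc, transvec_neg_mul, one_mul]
  have h1 := eta_mul (L := L) hp hP h (transvec φ (-(theta g v v)⁻¹) (v : V))
  rw [hg, spin_mul_spin_transvec_apply_zero h hb hv0, Finset.sum_eq_single 0, zero_smul,
    spin_apply_zero, zero_pow two_ne_zero, mul_zero, AddChar.map_zero_eq_one, mul_one, inv_one,
    one_mul, eta_transvec hp hP hb hv0, hc, inv_neg, neg_neg, inv_inv] at h1
  · rw [← h1, hc', chi_mul, pow_succ, mul_inv, mul_inv, inv_chi hv]
    ring
  · intro l _ hl
    rw [spin_apply_of_notMem h (coe_notMem_moved_transvec_mul g hv hl), mul_zero]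
  · exact fun h => absurd (Finset.mem_univ _) h

theorem etaFormula_of_isotropic (hp : p ≠ 2) (hP : IsHalfSystem P) (g : Sp φ) {v : moved g}
    (hv0 : v ≠ 0) (hv : theta g v v = 0)
    (h : EtaFormula hp P (transvec φ 1 (v : V) * g)) : EtaFormula hp P g := by
  obtain ⟨c', hc'⟩ := det_theta_transvec_mul_of_isotropic g (b := 1) hv (finBasis F (moved g))
  refine ⟨_, finBasis F (moved g), ?_⟩
  have hv0' : (v : V) ≠ 0 := fun h0 => hv0 (Subtype.ext h0)
  have h1 := eta_mul (L := L) hp hP g (transvec φ 1 (v : V))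
  have h2 : ∀ l : F, spin p g (l • (v : V)) = 1 := fun l => by
    have h3 := spin_apply_coe (p := p) g (l • v)
    rwa [thetaQuad_smul, hv, mul_zero, AddChar.map_zero_eq_one] at h3
  rw [spin_mul_spin_transvec_apply_zero g one_ne_zero hv0'] at h1
  simp only [h2, mul_one] at h1
  rw [sum_psi_mul_sq hp (by simp), ← eta_transvec hp hP one_ne_zero hv0', mul_comm] at h1
  rw [mul_left_cancel₀ (eta_ne_zero hp hP _) h1, h.eq c', hc', Fintype.card_fin]

theorem etaFormula (hp : p ≠ 2) (hP : IsHalfSystem P) (g : Sp φ) : EtaFormula hp P g := by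
  induction hd : finrank F (moved g) using Nat.strong_induction_on generalizing g with
  | _ d ih =>
  have key : ∀ g : Sp φ, finrank F (moved g) = d → (∃ v, theta g v v ≠ 0) →
      EtaFormula hp P g := by
    rintro g hd ⟨v, hv⟩
    refine etaFormula_of_anisotropic hp hP g hv (ih _ ?_ _ rfl)
    obtain ⟨c', -⟩ := det_theta_transvec_mul_of_anisotropic g hv (finBasis F _)
    have := finrank_eq_card_basis c'
    rw [Fintype.card_fin] at this
    omega
  by_cases hQ : ∃ v, theta g v v ≠ 0
  · exact key g hd hQ
  push Not at hQ
  by_cases h0 : ∃ v : moved g, v ≠ 0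
  · obtain ⟨v, hv⟩ := h0
    refine etaFormula_of_isotropic hp hP g hv (hQ v) (key _ ?_ ?_)
    · obtain ⟨c', -⟩ := det_theta_transvec_mul_of_isotropic g (b := 1) (hQ v) (finBasis F _)
      rw [finrank_eq_card_basis c', Fintype.card_fin, hd]
    · obtain ⟨u, hu⟩ := exists_theta_ne_zero g hv
      let r : LinearMap.range (thetaTransvec g 1 v) := ⟨_, u, rfl⟩
      refine ⟨movedTransvecMulEquiv g 1 v r, ?_⟩
      rw [theta_transvec_mul g 1 v r r u rfl]
      change theta g (thetaTransvec g 1 v u) u ≠ 0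
      have h1 := hQ (u + v)
      simp only [map_add, LinearMap.add_apply, hQ u, hQ v, zero_add, add_zero] at h1
      rw [thetaTransvec_apply, map_sub, map_smul, LinearMap.sub_apply, LinearMap.smul_apply, hQ u,
        one_mul, zero_sub, smul_eq_mul, neg_ne_zero]
      refine mul_ne_zero hu fun h2 => hu ?_
      rwa [h2, zero_add] at h1
  · push Not at h0
    have : Subsingleton (moved g) := ⟨fun x y => by rw [h0 x, h0 y]⟩
    have hg : g = 1 := by
      refine Subtype.ext (LinearEquiv.ext fun x => ?_)
      exact sub_eq_zero.mp (congrArg Subtype.val (h0 ((subOne g).rangeRestrict x)))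
    refine ⟨0, Basis.empty _, ?_⟩
    rw [Matrix.det_isEmpty, chi_one, pow_zero, inv_one, one_mul, hg, eta_one hp hP]

end

end WeilRep

open WeilRep Module in
theorem mainTheorem1
    {p : ℕ} [Fact p.Prime] (hp : p ≠ 2)
    {F : Type*} [Field F] [Fintype F] [Algebra (ZMod p) F]
    {V : Type*} [AddCommGroup V] [Module F V] [Fintype V]
    (φ : SymplecticForm F V) (n : ℕ) (hn : finrank F V = 2 * n)
    (L : LagrangianPair φ) (P : Set L.Wst) (hP : IsHalfSystem P) :
    -- `s(g)` is the unique unit with `(0)`-coefficient `1` and `s(g)⁻¹ (x) s(g) = (x^g)`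
    (∀ (g : Sp φ) (s : SympAlg p φ),
      (IsUnit s ∧ s 0 = 1 ∧
        ∀ x : V, SympAlg.of p φ x * s = s * SympAlg.of p φ ((g : V ≃ₗ[F] V) x)) ↔
      s = spin p g) ∧
    -- `t = η s` is an ordinary representation (`h * g` is `g` followed by `h`)
    weilRep p L hp P 1 = 1 ∧
    (∀ g h : Sp φ, weilRep p L hp P (h * g) = weilRep p L hp P g * weilRep p L hp P h) ∧
    -- the formulas for `η` and `ω`, with `det Θ_g` computed relative to any basis of `V^{g-1}`
    ∀ (g : Sp φ) {ι : Type*} [Fintype ι] [DecidableEq ι] (b : Basis ι F (moved g)),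
      eta p L hp P g =
        rho p F ^ (-(finrank F (moved g) : ℤ)) *
          chi p (LinearMap.BilinForm.toMatrix b (theta g)).det ∧
      weilCharacter p L hp P g =
        (Fintype.card F : CycField p) ^ n * rho p F ^ (-(finrank F (moved g) : ℤ)) *
          chi p (LinearMap.BilinForm.toMatrix b (theta g)).det := by
  refine ⟨eq_spin_iff hp, weilRep_one hp hP, weilRep_mul hp hP, fun g ι _ _ b => ?_⟩
  have h : eta p L hp P g = rho p F ^ (-(finrank F (moved g) : ℤ)) *
      chi p (LinearMap.BilinForm.toMatrix b (theta g)).det := by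
    rw [(etaFormula hp hP g).eq b, zpow_neg, zpow_natCast, finrank_eq_card_basis b]
  exact ⟨h, by rw [weilCharacter_eq hp hn, h, mul_assoc]⟩
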